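/- For $\alpha\in(0,\infty)$ and $t\in\mathbb R$ let $$T_{t,\alpha}=\begin{bmatrix} M & I_2\end{bmatrix}\begin{bmatrix}\Phi_{t}(1)\\ I_2\end{bmatrix}=M\,\Phi_{t}(1)+I_2,\qquad M=\tfrac12\begin{bmatrix}1&1\\1&1\end{bmatrix},$$ where $\Phi_{t}\colon[0,1]\to\mathbb C^{2\times 2}$ is the fundamental matrix of the system $v'(x)=-\mathrm i t\,\mathrm{diag}(1,\alpha)\,v(x)$ with $\Phi_t(0)=I_2$; that is, $T_{t,\alpha}=M\,\mathrm{diag}(\mathrm e^{-\mathrm it},\mathrm e^{-\mathrm i\alpha t})+I_2$. (These matrices belong to the port-Hamiltonian system on $[0,1]$ with $\mathcal H=\mathrm{diag}(1,\alpha)^{-1}$, $P_1=I_2$, $P_0=0$ and boundary matrix $W=\begin{bmatrix}M&I_2\end{bmatrix}$.) For $\eta\ge 0$ put $$m_\alpha(\eta)=\sup_{t\in[-\eta,\eta]}\bigl\|T_{t,\alpha}^{-1}\bigr\|,$$ with the operator norm induced by the Euclidean norm. A function $f\colon[0,\infty)\to(0,\infty)$ is of positive increase if there are $\beta>0$, $c\in(0,1]$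 and $t_0>0$ such that $f(\lambda t)/f(t)\ge c\lambda^{\beta}$ for all $\lambda\ge1$ and $t\ge t_0$. (If $\alpha$ is a quotient of two odd integers, then $T_{t,\alpha}$ is singular for some $t$, the function $m_\alpha$ is not finite-valued, and it does not count as being of positive increase; for every other $\alpha>0$ the function $m_\alpha$ is continuous with values in $(0,\infty)$.) Then the set $$\{\alpha\in(0,\infty): m_\alpha\text{ is of positive increase}\}$$ is a Lebesgue null set. -/

import Mathlib

/-!
The port-Hamiltonian systems considered here have a constant Hamiltonian density on the interval
`[0, 1]`.  The data are a symmetric positive definite matrix `H`, a symmetric invertible matrix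
`P₁`, a skew-symmetric matrix `P₀` and a matrix `W` of boundary conditions, all of them real.
-/

noncomputable section

open scoped Matrix Matrix.Norms.L2Operator

namespace PortHamiltonian

/-- The coefficient matrix `-P₁⁻¹ (i t H⁻¹ + P₀)` of the linear system `v' = -P₁⁻¹ (i t H⁻¹ + P₀) v`. -/
def odeCoeff {d : ℕ} (H P₁ P₀ : Matrix (Fin d) (Fin d) ℝ) (t : ℝ) :
    Matrix (Fin d) (Fin d) ℂ :=
  -((P₁⁻¹).map Complex.ofReal *
    ((Complex.I * (t : ℂ)) • (H⁻¹).map Complex.ofReal + P₀.map Complex.ofReal))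

/-- The fundamental matrix `Φ_t(x)` of `v' = -P₁⁻¹ (i t H⁻¹ + P₀) v`, normalised by `Φ_t(0) = 1`.
Since the coefficient matrix does not depend on `x`, it is a matrix exponential; see
`fundamentalMatrix_zero`, `hasDerivAt_fundamentalMatrix` and `fundamentalMatrix_unique`. -/
def fundamentalMatrix {d : ℕ} (H P₁ P₀ : Matrix (Fin d) (Fin d) ℝ) (t x : ℝ) :
    Matrix (Fin d) (Fin d) ℂ :=
  NormedSpace.exp (x • odeCoeff H P₁ P₀ t)

theorem fundamentalMatrix_zero {d : ℕ} (H P₁ P₀ : Matrix (Fin d) (Fin d) ℝ) (t : ℝ) :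
    fundamentalMatrix H P₁ P₀ t 0 = 1 := by
  simp [fundamentalMatrix]

theorem hasDerivAt_fundamentalMatrix {d : ℕ} (H P₁ P₀ : Matrix (Fin d) (Fin d) ℝ) (t x : ℝ) :
    HasDerivAt (fun y => fundamentalMatrix H P₁ P₀ t y)
      (odeCoeff H P₁ P₀ t * fundamentalMatrix H P₁ P₀ t x) x :=
  hasDerivAt_exp_smul_const' (𝕂 := ℝ) (odeCoeff H P₁ P₀ t) x

theorem fundamentalMatrix_unique {d : ℕ} (H P₁ P₀ : Matrix (Fin d) (Fin d) ℝ) (t : ℝ)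
    (V : ℝ → Matrix (Fin d) (Fin d) ℂ) (h0 : V 0 = 1)
    (hV : ∀ x, HasDerivAt V (odeCoeff H P₁ P₀ t * V x) x) :
    V = fun x => fundamentalMatrix H P₁ P₀ t x := by
  have hlip : ∀ s : ℝ, LipschitzOnWith (‖odeCoeff H P₁ P₀ t‖₊)
      (fun v : Matrix (Fin d) (Fin d) ℂ => odeCoeff H P₁ P₀ t * v) Set.univ := by
    intro s
    refine (LipschitzWith.of_dist_le_mul fun v w => ?_).lipschitzOnWith
    rw [dist_eq_norm, dist_eq_norm, ← mul_sub]
    exact norm_mul_le _ _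
  exact ODE_solution_unique_univ (v := fun _ v => odeCoeff H P₁ P₀ t * v)
    (s := fun _ => Set.univ) (t₀ := 0) hlip
    (fun x => ⟨hV x, trivial⟩)
    (fun x => ⟨hasDerivAt_fundamentalMatrix H P₁ P₀ t x, trivial⟩)
    (by rw [h0, fundamentalMatrix_zero])

/-- The matrix `T_t = W [Φ_t(1); 1]`. -/
def boundaryMatrix {d : ℕ} (H P₁ P₀ : Matrix (Fin d) (Fin d) ℝ)
    (W : Matrix (Fin d) (Fin d ⊕ Fin d) ℝ) (t : ℝ) : Matrix (Fin d) (Fin d) ℂ :=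
  W.map Complex.ofReal *
    Matrix.fromRows (fundamentalMatrix H P₁ P₀ t 1) (1 : Matrix (Fin d) (Fin d) ℂ)

/-- `m(η) = sup_{t ∈ [-η, η]} ‖T_t⁻¹‖`, with the operator norm induced by the Euclidean norm. -/
def resolventGrowth {d : ℕ} (H P₁ P₀ : Matrix (Fin d) (Fin d) ℝ)
    (W : Matrix (Fin d) (Fin d ⊕ Fin d) ℝ) (η : ℝ) : ℝ :=
  sSup ((fun t : ℝ => ‖(boundaryMatrix H P₁ P₀ W t)⁻¹‖) '' Set.Icc (-η) η)

/-- The Hamiltonian density `diag(1, α)⁻¹` of the example. -/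
def exampleH (α : ℝ) : Matrix (Fin 2) (Fin 2) ℝ := (!![1, 0; 0, α])⁻¹

/-- The matrix `M` with all entries `1 / 2`. -/
def exampleM : Matrix (Fin 2) (Fin 2) ℝ := (1 / 2 : ℝ) • !![1, 1; 1, 1]

/-- The boundary conditions `W = [M, 1]` of the example. -/
def exampleW : Matrix (Fin 2) (Fin 2 ⊕ Fin 2) ℝ := Matrix.fromCols exampleM 1

/-- The matrices `T_{t,α}` of the example `H = diag(1, α)⁻¹`, `P₁ = 1`, `P₀ = 0`, `W = [M, 1]`. -/
def exampleT (α t : ℝ) : Matrix (Fin 2) (Fin 2) ℂ :=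
  boundaryMatrix (exampleH α) 1 0 exampleW t

/-- The function `m_α` of the example.  For `α > 0` the matrix `T_{t,α}` is singular for some `t` only
if `α` is a quotient of two odd integers.  For such `α` the set of norms is unbounded as soon as `η`
is large, so the supremum is infinite in the usual sense and the real number `sSup` is `0`;
then `m_α` does not satisfy `HasPositiveIncrease` below, because `0 / 0 = 0`.
For all other `α > 0` the supremum is that of a continuous positive function on a compact interval. -/
def mAlpha (α : ℝ) : ℝ → ℝ := resolventGrowth (exampleH α) 1 0 exampleW

theorem mAlpha_apply (α η : ℝ) :
    mAlpha α η = sSup ((fun t : ℝ => ‖(exampleT α t)⁻¹‖) '' Set.Icc (-η) η) := rfl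

/-- The explicit form `T_{t,α} = M exp(-i t diag(1, α)) + 1`. -/
theorem exampleT_eq (α t : ℝ) (hα : 0 < α) :
    exampleT α t = exampleM.map Complex.ofReal *
      Matrix.diagonal ![Complex.exp (-(Complex.I * t)), Complex.exp (-(Complex.I * (α * t)))] + 1 := by
  have hdet : IsUnit (!![1, 0; 0, α] : Matrix (Fin 2) (Fin 2) ℝ).det := by
    simp [Matrix.det_fin_two_of, hα.ne']
  have hcoeff : odeCoeff (exampleH α) 1 0 t =
      Matrix.diagonal ![-(Complex.I * t), -(Complex.I * (α * t))] := by
    rw [odeCoeff, exampleH, Matrix.nonsing_inv_nonsing_inv _ hdet]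
    ext i j
    fin_cases i <;> fin_cases j <;> simp
    ring
  have hmap : exampleW.map Complex.ofReal =
      Matrix.fromCols (exampleM.map Complex.ofReal) 1 := by
    ext i j
    rcases j with j | j
    · simp [exampleW]
    · fin_cases i <;> fin_cases j <;> simp [exampleW]
  have hvec : NormedSpace.exp ![-(Complex.I * (t : ℂ)), -(Complex.I * (α * t))] =
      ![Complex.exp (-(Complex.I * t)), Complex.exp (-(Complex.I * (α * t)))] := by
    ext i
    rw [Pi.coe_exp, Complex.exp_eq_exp_ℂ]
    fin_cases i <;> simp
  rw [exampleT, boundaryMatrix, fundamentalMatrix, one_smul, hcoeff, Matrix.exp_diagonal, hvec,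
    hmap, Matrix.fromCols_mul_fromRows, Matrix.one_mul]

end PortHamiltonian

/-- Positive increase: there are `β > 0`, `c ∈ (0, 1]` and `t₀ > 0` such that
`f (λ t) / f t ≥ c λ ^ β` for all `λ ≥ 1` and `t ≥ t₀`.  The notion is usually defined for continuous
functions with positive values only.  These two properties are not made part of the condition. -/
def HasPositiveIncrease (f : ℝ → ℝ) : Prop :=
  ∃ β : ℝ, 0 < β ∧ ∃ c : ℝ, 0 < c ∧ c ≤ 1 ∧ ∃ t₀ : ℝ, 0 < t₀ ∧
    ∀ r : ℝ, 1 ≤ r → ∀ t : ℝ, t₀ ≤ t → c * r ^ β ≤ f (r * t) / f t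

end

noncomputable section

open scoped Matrix.Norms.L2Operator

/-! The norm of the inverse of `exampleT α t` is comparable to `1 / ‖charSum α t‖`, which is large
only where `t` and `α * t` are both near odd multiples `kπ` and `lπ`; its size there is at most of
order `1 / (k * α - l) ^ 2`, and this order is attained. So `m_α` is governed by approximation of
`α` by odd fractions. For almost every `α` there are, for every `ε`, infinitely many reduced odd `p
/ q` with error below `ε / q ^ 2` (`ae_forall_exists_odd_abs_sub_lt`). For `ε = 1 / (3 * r)` no odd
`l / k` with `|k| ≤ 3 * r * q` makes `|k * α - l|` smaller than `|q * α - p|`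
(`abs_mul_sub_le_of_odd`). Hence for some `t` near `πq` both `m_α(t)` and `m_α(r * t)` are of order
`1 / (q * α - p) ^ 2`, and their ratio is bounded independently of `r` (`exists_mAlpha_div_le`),
whereas positive increase forces it above `c * r ^ β`. -/

/-! ### Odd approximations of irrational numbers, with constant 12. -/

theorem Rat.finite_setOf_abs_sub_lt_one_and_den_le (ξ : ℝ) (N : ℕ) :
    {x : ℚ | |ξ - x| < 1 ∧ x.den ≤ N}.Finite := by
  refine Set.Finite.of_finite_image (f := fun x : ℚ => (x.num, x.den))
    (((Set.finite_Icc (-⌈(|ξ| + 1) * N⌉) ⌈(|ξ| + 1) * N⌉).prod (Set.finite_Icc 0 N)).subset ?_) ?_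
  · rintro _ ⟨x, ⟨hx, hN⟩, rfl⟩
    have hd : (0 : ℝ) < x.den := Nat.cast_pos.mpr x.pos
    have hN' : (x.den : ℝ) ≤ N := Nat.cast_le.mpr hN
    have hnum : (x.num : ℝ) = x * x.den := by exact_mod_cast (Rat.mul_den_eq_num x).symm
    have hxb : |(x : ℝ)| ≤ |ξ| + 1 := by
      have := abs_sub_abs_le_abs_sub (x : ℝ) ξ
      rw [abs_sub_comm] at this
      linarith
    have hb : |(x.num : ℝ)| ≤ (|ξ| + 1) * N := by
      rw [hnum, abs_mul, abs_of_pos hd]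
      gcongr
    have hc : |x.num| ≤ ⌈(|ξ| + 1) * N⌉ := by
      have : ((|x.num| : ℤ) : ℝ) ≤ (⌈(|ξ| + 1) * N⌉ : ℤ) := by
        push_cast
        exact hb.trans (Int.le_ceil _)
      exact_mod_cast this
    exact ⟨abs_le.mp hc, Nat.zero_le _, hN⟩
  · intro x _ y _ h
    exact Rat.ext (congrArg Prod.fst h) (congrArg Prod.snd h)

theorem Irrational.exists_rat_abs_sub_lt_and_le_den {ξ : ℝ} (hξ : Irrational ξ) (N : ℕ) :
    ∃ x : ℚ, |ξ - x| < 1 / (x.den : ℝ) ^ 2 ∧ N ≤ x.den := by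
  by_contra! h
  refine Real.infinite_rat_abs_sub_lt_one_div_den_sq_of_irrational hξ
    ((Rat.finite_setOf_abs_sub_lt_one_and_den_le ξ N).subset fun x hx => ⟨?_, (h x hx).le⟩)
  refine lt_of_lt_of_le hx ?_
  have : (1 : ℝ) ≤ x.den := by exact_mod_cast x.pos
  rw [div_le_one (by positivity)]
  exact one_le_pow₀ this

theorem Int.exists_mul_sub_mul_eq_one_of_isCoprime {n d : ℤ} (hd : 0 < d) (h : IsCoprime n d) :
    ∃ p q : ℤ, n * q - p * d = 1 ∧ d ≤ q ∧ q < 2 * d := by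
  obtain ⟨u, v, huv⟩ := h
  -- The Bézout solution `(-v, u)` is shifted by a multiple of `(n, d)` to bring `q` into `[d, 2d)`.
  refine ⟨-v - n * (u / d) + n, u % d + d, ?_, ?_, ?_⟩
  · rw [Int.emod_def]
    linear_combination huv
  · have := Int.emod_nonneg u hd.ne'
    linarith
  · have := Int.emod_lt_of_pos u hd
    linarith

/-- Beside every reduced fraction `n / d` which is not a quotient of odd integers there is one at
distance `1 / (d * q)` which is, with `d ≤ q < 3 * d`. -/
theorem Int.exists_odd_mul_sub_mul_eq_one {n d : ℤ} (hd : 0 < d) (h : IsCoprime n d)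
    (hnd : ¬(Odd n ∧ Odd d)) :
    ∃ p q : ℤ, n * q - p * d = 1 ∧ d ≤ q ∧ q < 3 * d ∧ Odd p ∧ Odd q := by
  obtain ⟨p, q, hpq, hq, hq'⟩ := Int.exists_mul_sub_mul_eq_one_of_isCoprime hd h
  by_cases ho : Odd p ∧ Odd q
  · exact ⟨p, q, hpq, hq, by linarith, ho⟩
  -- Modulo 2, determinant 1 makes `(n, d)` and `(p, q)` distinct nonzero vectors; if neither is
  -- `(1, 1)`, their sum is.
  · refine ⟨p + n, q + d, by linear_combination hpq, by linarith, by linarith, ?_⟩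
    have h1 : Odd (n * q - p * d) := by rw [hpq]; exact odd_one
    simp only [← Int.not_even_iff_odd, Int.even_add, Int.even_sub, Int.even_mul] at *
    tauto

theorem Irrational.exists_odd_abs_sub_lt {ξ : ℝ} (hξ : Irrational ξ) (N : ℕ) :
    ∃ (p : ℤ) (q : ℕ), N ≤ q ∧ Odd p ∧ Odd q ∧ IsCoprime p (q : ℤ) ∧
      |ξ - p / q| < 12 / (q : ℝ) ^ 2 := by
  obtain ⟨x, hx, hN⟩ := hξ.exists_rat_abs_sub_lt_and_le_den N
  have hd : (0 : ℝ) < x.den := Nat.cast_pos.mpr x.pos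
  have hcop : IsCoprime x.num (x.den : ℤ) := Rat.isCoprime_num_den x
  have hxe : (x : ℝ) = x.num / x.den := by exact_mod_cast (Rat.num_div_den x).symm
  by_cases ho : Odd x.num ∧ Odd (x.den : ℤ)
  · refine ⟨x.num, x.den, hN, ho.1, by exact_mod_cast ho.2, hcop, ?_⟩
    rw [← hxe]
    refine hx.trans ?_
    gcongr
    norm_num
  · obtain ⟨p, q, hdet, hq, hq', hp_odd, hq_odd⟩ :=
      Int.exists_odd_mul_sub_mul_eq_one (Int.natCast_pos.mpr x.pos) hcop ho
    lift q to ℕ using by linarith [Int.natCast_pos.mpr x.pos]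
    have hq1 : (x.den : ℝ) ≤ q := by exact_mod_cast hq
    have hq2 : (q : ℝ) < 3 * x.den := by exact_mod_cast hq'
    have hq0 : (0 : ℝ) < q := hd.trans_le hq1
    have hdetR : (x.num : ℝ) * q - p * x.den = 1 := by exact_mod_cast hdet
    refine ⟨p, q, hN.trans (by exact_mod_cast hq), hp_odd, by exact_mod_cast hq_odd,
      ⟨-x.den, x.num, by linear_combination hdet⟩, ?_⟩
    have hdist : (x : ℝ) - p / q = 1 / (x.den * q) := by
      rw [hxe]
      field_simp
      linarith
    calc |ξ - p / q| ≤ |ξ - x| + |(x : ℝ) - p / q| := abs_sub_le _ _ _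
      _ < 1 / (x.den : ℝ) ^ 2 + 1 / (x.den * q) := by
          rw [hdist, abs_of_pos (by positivity : (0 : ℝ) < 1 / (x.den * q))]
          gcongr
      -- Both terms come from `q < 3 * x.den`.
      _ ≤ 9 / (q : ℝ) ^ 2 + 3 / (q : ℝ) ^ 2 := by
          refine add_le_add ?_ ?_
          · rw [div_le_div_iff₀ (by positivity) (by positivity)]
            nlinarith
          · rw [div_le_div_iff₀ (by positivity) (by positivity)]
            nlinarith
      _ = 12 / (q : ℝ) ^ 2 := by ring

/-! ### Arbitrarily small constants for almost every number. -/

/-- The reduced fractions with denominator `q` and odd numerator and denominator. -/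
def oddFractions (q : ℕ) : Set ℝ :=
  {x | ∃ p : ℤ, Odd p ∧ Odd q ∧ IsCoprime p (q : ℤ) ∧ x = p / q}

theorem ae_irrational : ∀ᵐ α : ℝ, Irrational α := by
  rw [MeasureTheory.ae_iff]
  refine Set.Countable.measure_zero ?_ _
  simpa [Irrational, Set.range] using Set.countable_range ((↑) : ℚ → ℝ)

/-- Cassels' scaling principle: multiplying radii that tend to 0 by a fixed positive factor changes
the limsup of thickenings only by a null set. With radii `12 / q ^ 2` the limsup contains every
irrational. -/
theorem ae_frequently_mem_thickening_oddFractions {ε : ℝ} (hε : 0 < ε) :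
    ∀ᵐ α : ℝ, ∃ᶠ q : ℕ in Filter.atTop,
      α ∈ Metric.thickening (ε / (q : ℝ) ^ 2) (oddFractions q) := by
  have hr : Filter.Tendsto (fun q : ℕ => 12 / (q : ℝ) ^ 2) Filter.atTop (nhds 0) :=
    tendsto_const_nhds.div_atTop
      ((Filter.tendsto_pow_atTop two_ne_zero).comp tendsto_natCast_atTop_atTop)
  have key := blimsup_thickening_mul_ae_eq (MeasureTheory.volume : MeasureTheory.Measure ℝ)
    (fun _ => True) oddFractions (M := ε / 12) (by positivity) _ hr
  simp only [Filter.blimsup_true] at key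
  filter_upwards [key, ae_irrational] with α hα hirr
  have h12 : α ∈ Filter.limsup
      (fun q : ℕ => Metric.thickening (12 / (q : ℝ) ^ 2) (oddFractions q)) Filter.atTop := by
    rw [Filter.mem_limsup_iff_frequently_mem, Filter.frequently_atTop]
    intro N
    obtain ⟨p, q, hN, hp, hq, hpq, h⟩ := hirr.exists_odd_abs_sub_lt N
    exact ⟨q, hN, Metric.mem_thickening_iff.mpr ⟨_, ⟨p, hp, hq, hpq, rfl⟩, h⟩⟩
  have := (iff_of_eq hα).mpr h12
  replace this := Filter.mem_limsup_iff_frequently_mem.mp this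
  convert this using 3 with q
  ring_nf

/-- Almost every real number has, for every `ε > 0`, infinitely many reduced approximations `p / q`
with odd `p` and `q` and error less than `ε / q ^ 2`. -/
theorem ae_forall_exists_odd_abs_sub_lt :
    ∀ᵐ α : ℝ, ∀ ε : ℝ, 0 < ε → ∀ N : ℕ, ∃ (p : ℤ) (q : ℕ), N ≤ q ∧ Odd p ∧ Odd q ∧
      IsCoprime p (q : ℤ) ∧ |α - p / q| < ε / (q : ℝ) ^ 2 := by
  -- The exceptional null set depends on `ε`, so only the countably many values `1 / (n + 1)` are
  -- used.
  have h : ∀ᵐ α : ℝ, ∀ n : ℕ, ∃ᶠ q : ℕ in Filter.atTop,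
      α ∈ Metric.thickening ((1 / ((n : ℝ) + 1)) / (q : ℝ) ^ 2) (oddFractions q) :=
    MeasureTheory.ae_all_iff.mpr fun n =>
      ae_frequently_mem_thickening_oddFractions (by positivity)
  filter_upwards [h] with α hα ε hε N
  obtain ⟨n, hn⟩ := exists_nat_one_div_lt hε
  obtain ⟨q, hN, hq⟩ := Filter.frequently_atTop.mp (hα n) N
  obtain ⟨_, ⟨p, hp, hqo, hpq, rfl⟩, hlt⟩ := Metric.mem_thickening_iff.mp hq
  refine ⟨p, q, hN, hp, hqo, hpq, lt_of_lt_of_le hlt ?_⟩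
  gcongr

/-! ### Gaps between odd fractions. -/

/-- Oddness improves the usual gap 1 to 2; an error of size 1 can then be subtracted and still leave
1. -/
theorem Int.two_le_abs_mul_sub_mul_of_odd {p q k l : ℤ} (hp : Odd p) (hq : Odd q) (hk : Odd k)
    (hl : Odd l) (h : k * p ≠ l * q) : 2 ≤ |k * p - l * q| := by
  have heven : Even (k * p - l * q) := (hk.mul hp).sub_odd (hl.mul hq)
  exact Int.le_of_dvd (abs_pos.mpr (sub_ne_zero.mpr h)) ((dvd_abs _ _).mpr heven.two_dvd)

/-- A reduced odd fraction `p / q` very close to `α` is the best approximation of `α` among the odd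
fractions up to a much larger denominator. -/
theorem abs_mul_sub_le_of_odd {α ε R : ℝ} {p k l : ℤ} {q : ℕ} (hp : Odd p) (hq : Odd q)
    (hpq : IsCoprime p (q : ℤ)) (hk : Odd k) (hl : Odd l) (hε : ε ≤ 1)
    (happrox : |α - p / q| < ε / (q : ℝ) ^ 2) (hkR : |(k : ℝ)| ≤ R * q) (hR : R * ε ≤ 1) :
    |q * α - p| ≤ |k * α - l| := by
  have hq0 : (0 : ℝ) < q := Nat.cast_pos.mpr hq.pos
  have hqo : Odd (q : ℤ) := by exact_mod_cast hq
  have hδ : |q * α - p| * q < ε := by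
    have : q * α - p = q * (α - p / q) := by field_simp
    rw [this, abs_mul, abs_of_pos hq0]
    rw [lt_div_iff₀ (by positivity)] at happrox
    linarith
  refine le_of_mul_le_mul_left ?_ hq0
  rw [← abs_of_pos hq0, ← abs_mul, ← abs_mul, abs_of_pos hq0]
  have hid : (q : ℝ) * (k * α - l) = ((k * p - l * q : ℤ) : ℝ) + k * (q * α - p) := by
    push_cast; ring
  rw [hid]
  by_cases h : k * p = l * q
  -- Here `l / k` equals `p / q`, so `k` is a nonzero multiple of `q`.
  · rw [h, sub_self, Int.cast_zero, zero_add, abs_mul, abs_mul]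
    have hdvd : (q : ℤ) ∣ k := hpq.symm.dvd_of_dvd_mul_right ⟨l, by rw [h]; ring⟩
    have hle : (q : ℤ) ≤ |k| :=
      Int.le_of_dvd (abs_pos.mpr (by rintro rfl; simp at hk)) ((dvd_abs _ _).mpr hdvd)
    have : |(q : ℝ)| ≤ |(k : ℝ)| := by
      rw [abs_of_pos hq0]; exact_mod_cast hle
    gcongr
  · have h2 : (2 : ℝ) ≤ |((k * p - l * q : ℤ) : ℝ)| := by
      exact_mod_cast Int.two_le_abs_mul_sub_mul_of_odd hp hqo hk hl h
    have h3 : |(k : ℝ) * (q * α - p)| ≤ 1 := by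
      rw [abs_mul]
      have hε0 : 0 ≤ ε := (mul_nonneg (abs_nonneg _) hq0.le).trans hδ.le
      have hR0 : 0 ≤ R := nonneg_of_mul_nonneg_left ((abs_nonneg _).trans hkR) hq0
      calc |(k : ℝ)| * |q * α - p| ≤ R * q * |q * α - p| := by gcongr
        _ = R * (|q * α - p| * q) := by ring
        _ ≤ R * ε := by gcongr
        _ ≤ 1 := hR
    have h4 : |(q : ℝ) * (q * α - p)| ≤ 1 := by
      rw [abs_mul, abs_of_pos hq0]; linarith
    have h5 := abs_sub_abs_le_abs_sub ((k * p - l * q : ℤ) : ℝ) (-(k * (q * α - p)))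
    rw [abs_neg, sub_neg_eq_add] at h5
    linarith

/-! ### The inverse of `T` compared with its determinant. -/

theorem Matrix.norm_apply_le_l2_opNorm {m n : Type*} [Fintype m] [Fintype n] [DecidableEq n]
    (A : Matrix m n ℂ) (i : m) (j : n) : ‖A i j‖ ≤ ‖A‖ := by
  have h := Matrix.l2_opNorm_mulVec A (EuclideanSpace.single j 1)
  rw [PiLp.norm_single, norm_one, mul_one] at h
  refine le_trans (le_of_eq ?_) ((PiLp.norm_apply_le _ i).trans h)
  simp

namespace PortHamiltonian

/-- Twice the determinant of `T_{t,α}`. -/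
def charSum (α t : ℝ) : ℂ :=
  2 + Complex.exp (-(Complex.I * t)) + Complex.exp (-(Complex.I * (α * t)))

theorem norm_exp_neg_I_mul (t : ℝ) : ‖Complex.exp (-(Complex.I * t))‖ = 1 := by
  simp [Complex.norm_exp]

theorem norm_exp_neg_I_mul_mul (α t : ℝ) : ‖Complex.exp (-(Complex.I * (α * t)))‖ = 1 := by
  simp [Complex.norm_exp]

theorem exampleT_eq_of (α t : ℝ) (hα : 0 < α) :
    exampleT α t = !![1 + Complex.exp (-(Complex.I * t)) / 2,
      Complex.exp (-(Complex.I * (α * t))) / 2; Complex.exp (-(Complex.I * t)) / 2,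
      1 + Complex.exp (-(Complex.I * (α * t))) / 2] := by
  rw [exampleT_eq α t hα]
  ext i j
  fin_cases i <;> fin_cases j <;> simp [exampleM] <;> ring

theorem exampleT_inv (α t : ℝ) (hα : 0 < α) :
    (exampleT α t)⁻¹ = (charSum α t / 2)⁻¹ • (exampleT α t).adjugate := by
  have hdet : (exampleT α t).det = charSum α t / 2 := by
    rw [exampleT_eq_of α t hα, Matrix.det_fin_two_of, charSum]
    ring
  rw [Matrix.inv_def, hdet, Ring.inverse_eq_inv]

/-- One entry of the adjugate is `1 + z / 2` with `‖z‖ = 1`, so its modulus is at least `1 / 2`. If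
`charSum` vanishes, both sides are 0 by convention. -/
theorem inv_norm_charSum_le (α t : ℝ) (hα : 0 < α) :
    ‖charSum α t‖⁻¹ ≤ ‖(exampleT α t)⁻¹‖ := by
  refine le_trans ?_ (Matrix.norm_apply_le_l2_opNorm _ 0 0)
  rw [exampleT_inv α t hα, exampleT_eq_of α t hα, Matrix.adjugate_fin_two_of]
  have h : (1 : ℝ) / 2 ≤ ‖1 + Complex.exp (-(Complex.I * (α * t))) / 2‖ := by
    have h1 := norm_sub_norm_le (1 : ℂ) (-(Complex.exp (-(Complex.I * (α * t))) / 2))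
    rw [norm_neg, sub_neg_eq_add, norm_div, norm_exp_neg_I_mul_mul] at h1
    norm_num at h1 ⊢
    linarith
  simp only [Matrix.smul_apply, Matrix.of_apply, Matrix.cons_val_zero, smul_eq_mul,
    norm_mul, norm_inv, norm_div, Complex.norm_ofNat, Matrix.cons_val', Matrix.cons_val_fin_one]
  rw [inv_div]
  calc ‖charSum α t‖⁻¹ = 2 / ‖charSum α t‖ * (1 / 2) := by ring
    _ ≤ _ := by gcongr

/-- For a 2×2 matrix the adjugate is the trace times the identity minus the matrix; the 4 collects 3
from the trace and 1 from the identity in `T`. -/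
theorem norm_exampleT_inv_le (α t : ℝ) (hα : 0 < α) :
    ‖(exampleT α t)⁻¹‖ ≤
      2 * (4 + ‖exampleM.map Complex.ofReal‖) * ‖charSum α t‖⁻¹ := by
  have hadj : (exampleT α t).adjugate =
      (2 + (Complex.exp (-(Complex.I * t)) + Complex.exp (-(Complex.I * (α * t)))) / 2) •
        (1 : Matrix (Fin 2) (Fin 2) ℂ) - exampleT α t := by
    rw [exampleT_eq_of α t hα, Matrix.adjugate_fin_two_of]
    ext i j
    fin_cases i <;> fin_cases j <;> simp <;> ring
  have hT : ‖exampleT α t‖ ≤ ‖exampleM.map Complex.ofReal‖ + 1 := by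
    rw [exampleT_eq α t hα]
    refine (norm_add_le _ _).trans ?_
    rw [norm_one]
    gcongr
    refine (norm_mul_le _ _).trans (mul_le_of_le_one_right (norm_nonneg _) ?_)
    rw [Matrix.l2_opNorm_diagonal, pi_norm_le_iff_of_nonneg zero_le_one]
    intro i
    fin_cases i
    · simp [norm_exp_neg_I_mul]
    · simp [norm_exp_neg_I_mul_mul]
  have htr : ‖2 + (Complex.exp (-(Complex.I * t)) + Complex.exp (-(Complex.I * (α * t)))) / 2‖
      ≤ 3 := by
    refine (norm_add_le _ _).trans ?_
    rw [norm_div, Complex.norm_ofNat]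
    have := norm_add_le (Complex.exp (-(Complex.I * t))) (Complex.exp (-(Complex.I * (α * t))))
    rw [norm_exp_neg_I_mul, norm_exp_neg_I_mul_mul] at this
    linarith
  rw [exampleT_inv α t hα, norm_smul, norm_inv, norm_div, Complex.norm_ofNat, inv_div]
  calc 2 / ‖charSum α t‖ * ‖(exampleT α t).adjugate‖
      ≤ 2 / ‖charSum α t‖ * (4 + ‖exampleM.map Complex.ofReal‖) := by
        gcongr
        rw [hadj]
        refine (norm_sub_le _ _).trans ?_
        rw [norm_smul, norm_one]
        linarith
    _ = _ := by ring

theorem charSum_re (α t : ℝ) : (charSum α t).re = 2 + Real.cos t + Real.cos (α * t) := by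
  simp [charSum, Complex.exp_re]

theorem charSum_im (α t : ℝ) : (charSum α t).im = -(Real.sin t + Real.sin (α * t)) := by
  simp [charSum, Complex.exp_im]
  ring

end PortHamiltonian

/-! ### Size of the determinant near odd multiples of π. -/

/-- With `u` the distance to the nearest odd multiple of π, `1 + cos t = 2 sin² (u / 2)`, and
Jordan's inequality bounds the sine from below. -/
theorem Real.exists_odd_sq_sub_mul_pi_le (t : ℝ) :
    ∃ k : ℤ, Odd k ∧ |t - k * Real.pi| ≤ Real.pi ∧
      (t - k * Real.pi) ^ 2 ≤ Real.pi ^ 2 / 2 * (1 + Real.cos t) := by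
  have hpi := Real.pi_pos
  refine ⟨2 * round ((t - Real.pi) / (2 * Real.pi)) + 1, odd_two_mul_add_one _, ?_⟩
  set n := round ((t - Real.pi) / (2 * Real.pi)) with hn
  have hround := abs_sub_round ((t - Real.pi) / (2 * Real.pi))
  rw [← hn] at hround
  push_cast
  obtain ⟨u, hu⟩ : ∃ u, u = t - (2 * n + 1) * Real.pi := ⟨_, rfl⟩
  rw [← hu]
  have hu' : u = 2 * Real.pi * ((t - Real.pi) / (2 * Real.pi) - n) := by
    rw [hu]; field_simp; ring
  have hu2 : |u| ≤ Real.pi := by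
    rw [hu', abs_mul, abs_of_pos (by positivity)]
    nlinarith
  refine ⟨hu2, ?_⟩
  have hcos : Real.cos t = -Real.cos u := by
    have : t = u + Real.pi + n * (2 * Real.pi) := by rw [hu]; ring
    rw [this, Real.cos_add_int_mul_two_pi, Real.cos_add_pi]
  have hsin := Real.mul_abs_le_abs_sin (x := u / 2) (by
    rw [abs_div, abs_two]; linarith)
  have hsq : (2 / Real.pi * |u / 2|) ^ 2 ≤ Real.sin (u / 2) ^ 2 := by
    rw [← sq_abs (Real.sin _)]
    gcongr
  rw [mul_pow, sq_abs, Real.sin_sq_eq_half_sub, mul_div_cancel₀ _ two_ne_zero] at hsq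
  rw [hcos]
  have h3 : (2 / Real.pi) ^ 2 * (u / 2) ^ 2 = u ^ 2 / Real.pi ^ 2 := by
    field_simp
  rw [h3, div_le_iff₀ (by positivity)] at hsq
  linarith

namespace PortHamiltonian

/-- A small value of `charSum` comes with a good approximation of `α` by a quotient of odd integers. -/
theorem exists_odd_sq_le_norm_charSum {α t : ℝ} (hα : 0 < α) :
    ∃ k l : ℤ, Odd k ∧ Odd l ∧ |t - k * Real.pi| ≤ Real.pi ∧
      (k * α - l) ^ 2 ≤ (1 + α) ^ 2 * ‖charSum α t‖ := by
  have hpi := Real.pi_pos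
  obtain ⟨k, hk, hkt, hk2⟩ := Real.exists_odd_sq_sub_mul_pi_le t
  obtain ⟨l, hl, -, hl2⟩ := Real.exists_odd_sq_sub_mul_pi_le (α * t)
  refine ⟨k, l, hk, hl, hkt, ?_⟩
  have hre : 2 + Real.cos t + Real.cos (α * t) ≤ ‖charSum α t‖ := by
    rw [← charSum_re]; exact Complex.re_le_norm _
  obtain ⟨u, hu⟩ : ∃ u, u = t - k * Real.pi := ⟨_, rfl⟩
  obtain ⟨v, hv⟩ : ∃ v, v = α * t - l * Real.pi := ⟨_, rfl⟩
  rw [← hu] at hk2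
  rw [← hv] at hl2
  have hsum : u ^ 2 + v ^ 2 ≤ Real.pi ^ 2 / 2 * ‖charSum α t‖ := by
    refine (add_le_add hk2 hl2).trans ?_
    rw [← mul_add]
    gcongr
    linarith
  -- The combination `v - α * u` eliminates `t`.
  have hid : Real.pi ^ 2 * (k * α - l) ^ 2 = (v - α * u) ^ 2 := by
    rw [hu, hv]; ring
  have hcs : (v - α * u) ^ 2 ≤ (1 + α) ^ 2 * (u ^ 2 + v ^ 2) := by
    nlinarith [sq_nonneg (u + α * v), mul_nonneg hα.le (add_nonneg (sq_nonneg u) (sq_nonneg v))]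
  have hpi2 : 0 < Real.pi ^ 2 := by positivity
  refine le_of_mul_le_mul_left ?_ hpi2
  have hn := norm_nonneg (charSum α t)
  calc Real.pi ^ 2 * (k * α - l) ^ 2 ≤ (1 + α) ^ 2 * (u ^ 2 + v ^ 2) := by rw [hid]; exact hcs
    _ ≤ (1 + α) ^ 2 * (Real.pi ^ 2 / 2 * ‖charSum α t‖) := by gcongr
    _ ≤ Real.pi ^ 2 * ((1 + α) ^ 2 * ‖charSum α t‖) := by
      have : 0 ≤ Real.pi ^ 2 * ((1 + α) ^ 2 * ‖charSum α t‖) := by positivity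
      linarith

/-- At the time `(p + q) π / (1 + α)` with odd `p` and `q` the function `charSum` is as small as
the square of the error `q α - p`. -/
theorem norm_charSum_le {α : ℝ} (hα : 0 < α) {p q : ℤ} (hp : Odd p) (hq : Odd q) :
    ‖charSum α ((p + q) * Real.pi / (1 + α))‖ ≤
      (Real.pi / (1 + α)) ^ 2 * (q * α - p) ^ 2 := by
  obtain ⟨t, ht⟩ : ∃ t, t = (p + q) * Real.pi / (1 + α) := ⟨_, rfl⟩
  obtain ⟨w, hw⟩ : ∃ w, w = Real.pi / (1 + α) * (q * α - p) := ⟨_, rfl⟩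
  rw [← ht, ← mul_pow, ← hw]
  have h1α : 1 + α ≠ 0 := by positivity
  obtain ⟨m, rfl⟩ := hp
  obtain ⟨n, rfl⟩ := hq
  -- At this time `t` and `α * t` miss their odd multiples of π by opposite amounts, so the
  -- imaginary parts, which are of first order in `w`, cancel.
  have h1 : t = -w + Real.pi + n * (2 * Real.pi) := by
    rw [ht, hw]; push_cast; field_simp; ring
  have h2 : α * t = w + Real.pi + m * (2 * Real.pi) := by
    rw [ht, hw]; push_cast; field_simp; ring
  have hval : charSum α t = ((2 - 2 * Real.cos w : ℝ) : ℂ) := by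
    apply Complex.ext
    · rw [charSum_re, Complex.ofReal_re, h2, h1, Real.cos_add_int_mul_two_pi,
        Real.cos_add_int_mul_two_pi, Real.cos_add_pi, Real.cos_add_pi, Real.cos_neg]
      ring
    · rw [charSum_im, Complex.ofReal_im, h2, h1, Real.sin_add_int_mul_two_pi,
        Real.sin_add_int_mul_two_pi, Real.sin_add_pi, Real.sin_add_pi, Real.sin_neg]
      ring
  rw [hval, Complex.norm_of_nonneg (by linarith [Real.cos_le_one w])]
  linarith [Real.one_sub_sq_div_two_le_cos (x := w)]

/-! ### Bounds for `m_α` on long intervals. -/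

theorem mAlpha_le {α η δ : ℝ} (hη : 0 ≤ η)
    (hδ : ∀ t ∈ Set.Icc (-η) η, ‖(exampleT α t)⁻¹‖ ≤ δ) : mAlpha α η ≤ δ := by
  rw [mAlpha_apply]
  refine csSup_le (Set.Nonempty.image _ ⟨0, by simpa using hη⟩) ?_
  rintro _ ⟨t, ht, rfl⟩
  exact hδ t ht

/-- The bound `δ` is needed because the real `sSup` of an unbounded set is 0. -/
theorem le_mAlpha {α η δ t : ℝ} (hδ : ∀ t ∈ Set.Icc (-η) η, ‖(exampleT α t)⁻¹‖ ≤ δ)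
    (ht : t ∈ Set.Icc (-η) η) : ‖(exampleT α t)⁻¹‖ ≤ mAlpha α η := by
  rw [mAlpha_apply]
  refine le_csSup ⟨δ, ?_⟩ ⟨t, ht, rfl⟩
  rintro _ ⟨s, hs, rfl⟩
  exact hδ s hs

/-- If `α` has odd approximations of arbitrarily small relative error, then `m_α` is almost constant
on arbitrarily long intervals `[t, r t]`. -/
theorem exists_mAlpha_div_le {α : ℝ} (hα : 0 < α) (hirr : Irrational α)
    (happrox : ∀ ε : ℝ, 0 < ε → ∀ N : ℕ, ∃ (p : ℤ) (q : ℕ), N ≤ q ∧ Odd p ∧ Odd q ∧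
      IsCoprime p (q : ℤ) ∧ |α - p / q| < ε / (q : ℝ) ^ 2)
    {r : ℝ} (hr : 1 ≤ r) (t₀ : ℝ) :
    ∃ t, t₀ ≤ t ∧ mAlpha α (r * t) / mAlpha α t ≤
      2 * (4 + ‖exampleM.map Complex.ofReal‖) * Real.pi ^ 2 := by
  have hpi := Real.pi_pos
  obtain ⟨p, q, hN, hp, hq, hpq, h⟩ :=
    -- The factor `3 * r` matches the bound `|k| ≤ 3 * r * q` below; the lower bound on `q` ensures
    -- `t₀ ≤ π(q - 1) ≤ t`.
    happrox (1 / (3 * r)) (by positivity) (⌈|t₀|⌉₊ + 1)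
  have hq1 : (1 : ℝ) ≤ q := by exact_mod_cast hq.pos
  have hq0 : (0 : ℝ) < q := by linarith
  have hqt : t₀ + 1 ≤ q := by
    have h1 : ((⌈|t₀|⌉₊ + 1 : ℕ) : ℝ) ≤ q := by exact_mod_cast hN
    push_cast at h1
    linarith [Nat.le_ceil |t₀|, le_abs_self t₀]
  obtain ⟨e, he⟩ : ∃ e, e = q * α - p := ⟨_, rfl⟩
  have he0 : e ≠ 0 := by
    intro h0
    refine hirr ⟨p / q, ?_⟩
    push_cast
    field_simp
    linarith
  have he1 : |e| ≤ 1 := by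
    have h1 : e = q * (α - p / q) := by rw [he]; field_simp
    rw [h1, abs_mul, abs_of_pos hq0]
    calc q * |α - p / q| ≤ q * (1 / (3 * r) / (q : ℝ) ^ 2) := by gcongr
      _ = 1 / (3 * r * q) := by field_simp
      _ ≤ 1 := by
        rw [div_le_one (by positivity)]
        nlinarith
  obtain ⟨t, ht⟩ : ∃ t, t = (p + (q : ℤ)) * Real.pi / (1 + α) := ⟨_, rfl⟩
  have htq : t = Real.pi * q - Real.pi * (e / (1 + α)) := by
    rw [ht, he]; push_cast; field_simp; ring
  have hfrac : |e / (1 + α)| ≤ 1 := by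
    rw [abs_div, abs_of_pos (by positivity : 0 < 1 + α), div_le_one (by positivity)]
    linarith
  obtain ⟨hf1, hf2⟩ := abs_le.mp hfrac
  have ht_le : t ≤ Real.pi * (q + 1) := by rw [htq]; nlinarith
  have ht_ge : Real.pi * (q - 1) ≤ t := by rw [htq]; nlinarith
  have ht_nonneg : 0 ≤ t := le_trans (mul_nonneg hpi.le (by linarith)) ht_ge
  have ht_t₀ : t₀ ≤ t := by
    have := Real.pi_gt_three
    nlinarith
  have hC : 0 < 4 + ‖exampleM.map Complex.ofReal‖ := by positivity
  set C := 4 + ‖exampleM.map Complex.ofReal‖ with hCdef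
  have hchar : ∀ s ∈ Set.Icc (-(r * t)) (r * t), e ^ 2 ≤ (1 + α) ^ 2 * ‖charSum α s‖ := by
    intro s hs
    obtain ⟨k, l, hk, hl, hks, hkl⟩ := exists_odd_sq_le_norm_charSum (t := s) hα
    have hkR : |(k : ℝ)| ≤ 3 * r * q := by
      have h1 := abs_sub_abs_le_abs_sub (k * Real.pi) s
      rw [abs_sub_comm, abs_mul, abs_of_pos hpi] at h1
      have h2 : |s| ≤ r * (Real.pi * (q + 1)) :=
        (abs_le.mpr hs).trans (by gcongr)
      -- Since `r` and `q` are at least 1, the right side is at most `3 * r * q`.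
      have h3 : |(k : ℝ)| ≤ r * (q + 1) + 1 := by
        refine le_of_mul_le_mul_right ?_ hpi
        linarith
      nlinarith
    have hgap := abs_mul_sub_le_of_odd hp hq hpq hk hl
      (by rw [div_le_one (by positivity)]; linarith) h hkR
      (by rw [mul_one_div_cancel (by positivity)])
    rw [← he] at hgap
    exact (sq_le_sq.mpr hgap).trans hkl
  have he2 : 0 < e ^ 2 := by positivity
  have hchar_pos : ∀ s ∈ Set.Icc (-(r * t)) (r * t), 0 < ‖charSum α s‖ := fun s hs =>
    pos_of_mul_pos_right (he2.trans_le (hchar s hs)) (by positivity)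
  have hbound : ∀ s ∈ Set.Icc (-(r * t)) (r * t),
      ‖(exampleT α s)⁻¹‖ ≤ 2 * C * ((1 + α) ^ 2 / e ^ 2) := by
    intro s hs
    refine (norm_exampleT_inv_le α s hα).trans ?_
    gcongr
    rw [inv_le_iff_one_le_mul₀ (hchar_pos s hs), div_mul_eq_mul_div, one_le_div he2]
    exact hchar s hs
  have htr : t ≤ r * t := le_mul_of_one_le_left ht_nonneg hr
  have hupper := mAlpha_le (ht_nonneg.trans htr) hbound
  have hlower : (1 + α) ^ 2 / (Real.pi ^ 2 * e ^ 2) ≤ mAlpha α t := by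
    refine le_trans ?_ (le_mAlpha (t := t)
      (fun s hs => hbound s ⟨by linarith [hs.1], hs.2.trans htr⟩) ⟨by linarith, le_rfl⟩)
    refine le_trans ?_ (inv_norm_charSum_le α t hα)
    have hle := norm_charSum_le hα hp (q := (q : ℤ)) (by exact_mod_cast hq)
    rw [← ht, Int.cast_natCast, ← he] at hle
    calc (1 + α) ^ 2 / (Real.pi ^ 2 * e ^ 2) = ((Real.pi / (1 + α)) ^ 2 * e ^ 2)⁻¹ := by
          field_simp
      _ ≤ ‖charSum α t‖⁻¹ := inv_anti₀ (hchar_pos t ⟨by linarith, htr⟩) hle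
  refine ⟨t, ht_t₀, ?_⟩
  have hpos : 0 < (1 + α) ^ 2 / (Real.pi ^ 2 * e ^ 2) := by positivity
  rw [div_le_iff₀ (hpos.trans_le hlower)]
  -- Both `e` and `α` cancel in the quotient, leaving a constant free of `r`.
  calc mAlpha α (r * t) ≤ 2 * C * ((1 + α) ^ 2 / e ^ 2) := hupper
    _ = 2 * C * Real.pi ^ 2 * ((1 + α) ^ 2 / (Real.pi ^ 2 * e ^ 2)) := by field_simp
    _ ≤ _ := by gcongr

end PortHamiltonian

end

theorem theorem5p5 :
    MeasureTheory.volume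
      {α : ℝ | 0 < α ∧ HasPositiveIncrease (PortHamiltonian.mAlpha α)} = 0 := by
  have h : ∀ᵐ α : ℝ, ¬(0 < α ∧ HasPositiveIncrease (PortHamiltonian.mAlpha α)) := by
    filter_upwards [ae_irrational, ae_forall_exists_odd_abs_sub_lt] with α hirr happrox
    rintro ⟨hα, β, hβ, c, hc, -, t₀, -, hinc⟩
    have hlim : Filter.Tendsto (fun r : ℝ => c * r ^ β) Filter.atTop Filter.atTop :=
      (tendsto_rpow_atTop hβ).const_mul_atTop hc
    obtain ⟨r, hr, hr1⟩ := ((hlim.eventually_gt_atTop _).and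
      (Filter.eventually_ge_atTop 1)).exists
    obtain ⟨t, ht, hle⟩ := PortHamiltonian.exists_mAlpha_div_le hα hirr happrox hr1 t₀
    exact absurd ((hinc r hr1 t ht).trans hle) (not_le.mpr hr)
  simpa [MeasureTheory.ae_iff] using h
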